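/- Let $\mathfrak g_{2,1}=\mathfrak{aff}(\mathbb R)$ be the two-dimensional non-abelian real Lie algebra and $\mathfrak g_1=\mathbb R$ the one-dimensional one, and let $\mathfrak g$ be a real Lie algebra isomorphic to $\mathfrak g_{2,1}\oplus\mathfrak g_1$. (1) $\mathfrak g$ has an ordered basis $(E_1,E_2,E_3)$ with $[E_1,E_2]=0$, $[E_3,E_1]=E_1-E_2$, $[E_2,E_3]=E_1-E_2$. For every such basis and every derivation $\mathcal D$ of $\mathfrak g$ there are $x_1,x_2,x_3,y_3\in\mathbb R$ such that the matrix of $\mathcal D$ in this basis (the columns being the coordinates of $\mathcal D E_1,\mathcal D E_2,\mathcal D E_3$) is $$\begin{pmatrix} x_1&x_2&x_3\\ x_2&x_1&y_3\\ 0&0&0\end{pmatrix},$$ and the complex eigenvalues of $\mathcal D$, counted with algebraic multiplicity, are $0$, $x_1-x_2$, $x_1+x_2$; in particular they are all real. (2) Let $G$ be a connected, simply connected real Lie group whose Lie algebra is isomorphic to $\mathfrak g_{2,1}\oplus\mathfrak g_1$, and let $\mathcal X$ be a linear vector field on $G$, that is, a smooth vector field with a global flow $(\varphi_t)_{t\in\mathbb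 R}$ consisting of automorphisms of the Lie group $G$. Then the linear flow $\varphi_t$ has no periodic orbits: there is no $g\in G$ that is not a fixed point of the flow and for which there is a $T>0$ with $\varphi_{t+T}(g)=\varphi_t(g)$ for all $t\in\mathbb R$. -/

import Mathlib

open scoped Manifold ContDiff

noncomputable section

section LieAlgebras

-- Matrices and real numbers carry the commutator bracket.
attribute [local instance 100] LieRing.ofAssociativeRing

/-- The two-dimensional nonabelian real Lie algebra `𝔤_{2,1} = aff(ℝ)`: the real `2 × 2` matrices
whose second row is zero, with the commutator bracket. -/
def affLie : LieSubalgebra ℝ (Matrix (Fin 2) (Fin 2) ℝ) where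
  carrier := {A | ∀ j, A 1 j = 0}
  add_mem' := by
    intro A B hA hB j
    simp [hA j, hB j]
  zero_mem' := by
    intro j
    simp
  smul_mem' := by
    intro c A hA j
    simp [hA j]
  lie_mem' := by
    intro A B hA hB j
    simp [Ring.lie_def, Matrix.mul_apply, Fin.sum_univ_two, hA 0, hA 1, hB 0, hB 1]

/-- A real Lie algebra is of type `𝔤_{2,1} ⊕ 𝔤_1` if it is isomorphic to the direct sum of
`aff(ℝ)` and the one-dimensional Lie algebra `ℝ` (whose bracket, the commutator, is zero). -/
def IsTypeG21G1 (L : Type*) [LieRing L] [LieAlgebra ℝ L] : Prop :=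
  Nonempty (L ≃ₗ⁅ℝ⁆ (affLie × ℝ))

end LieAlgebras

/-- The ordered bases `(E₁, E₂, E₃)` with `[E₁, E₂] = 0`, `[E₃, E₁] = E₁ - E₂`,
`[E₂, E₃] = E₁ - E₂`; they are indexed by `0, 1, 2`. -/
structure IsAdaptedBasis {L : Type*} [LieRing L] [LieAlgebra ℝ L]
    (E : Module.Basis (Fin 3) ℝ L) : Prop where
  lie_12 : ⁅E 0, E 1⁆ = 0
  lie_31 : ⁅E 2, E 0⁆ = E 0 - E 1
  lie_23 : ⁅E 1, E 2⁆ = E 0 - E 1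

/-- A smooth real Lie group is in particular as smooth as Mathlib asks for in order to define
its Lie algebra. -/
instance lieGroup_minSmoothness {E : Type*} [NormedAddCommGroup E] [NormedSpace ℝ E]
    {H : Type*} [TopologicalSpace H] (I : ModelWithCorners ℝ E H)
    (G : Type*) [TopologicalSpace G] [ChartedSpace H G] [Group G] [LieGroup I ∞ G] :
    LieGroup I (minSmoothness ℝ 3) G :=
  LieGroup.of_le (n := ∞) (by
    rw [minSmoothness_of_isRCLikeNormedField]
    exact ENat.LEInfty.out)

section Flows

variable {E : Type*} [NormedAddCommGroup E] [NormedSpace ℝ E] {H : Type*} [TopologicalSpace H]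
  (I : ModelWithCorners ℝ E H) {G : Type*} [TopologicalSpace G] [ChartedSpace H G]

/-- `f` is an automorphism of the Lie group `G`: a group automorphism that is a diffeomorphism. -/
def IsLieGroupAut [Group G] (f : G → G) : Prop :=
  (∀ g h : G, f (g * h) = f g * f h) ∧ ∃ Φ : Diffeomorph I I G G ∞, ⇑Φ = f

/-- `φ` is the global flow of the vector field `X`: every curve `t ↦ φ t g` is the solution of
`ġ = X(g)` on the whole real line that starts at `g`. -/
structure IsFlowOf (X : ∀ g : G, TangentSpace I g) (φ : ℝ → G → G) : Prop where
  map_zero : ∀ g : G, φ 0 g = g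
  isMIntegralCurve : ∀ g : G, IsMIntegralCurve (I := I) (fun t : ℝ => φ t g) X

/-- `X` is a linear vector field on the Lie group `G` with (linear) flow `φ`: `X` is smooth,
`φ` is its flow, and every `φ t` is an automorphism of the Lie group `G`. -/
structure IsLinearFlow [Group G] [LieGroup I ∞ G]
    (X : ∀ g : G, TangentSpace I g) (φ : ℝ → G → G) : Prop where
  smooth : ContMDiff I I.tangent ∞ (fun g : G => (⟨g, X g⟩ : TangentBundle I G))
  isFlowOf : IsFlowOf I X φ
  isLieGroupAut : ∀ t : ℝ, IsLieGroupAut I (φ t)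

end Flows

/-- The orbit of `g` under the flow `φ` is a periodic orbit: it repeats with some period `T > 0`,
and `g` is not a fixed point of the flow. -/
def IsPeriodicOrbit {G : Type*} (φ : ℝ → G → G) (g : G) : Prop :=
  (∃ T : ℝ, 0 < T ∧ ∀ t : ℝ, φ (t + T) g = φ t g) ∧ ¬ ∀ t : ℝ, φ t g = g

end

/-! Part (1) is linear algebra: the Leibniz rule on the three bracket relations gives linear
equations for the entries of a derivation, and the characteristic polynomial factors by inspection.

Part (2) does not go through eigenvalues; it uses global coordinates on `G`. Let `E^i` be the
left-invariant forms dual to an adapted basis. The forms `E^2` and `E^0 + E^1` are closed, and `E^0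
- E^1` becomes closed after multiplication by `exp (2 s)`, where `ds = E^2`. Simple connectedness
yields primitives `s`, `z`, `y` (`exists_primitive`). The differential of an automorphism is so
restricted (`IsAdaptedBasis.repr_endomorphism`) that every automorphism fixes `s` and acts on each
of `s`, `z`, `y` by a real affine bijection depending only on `s` (`exists_affineCoords`).

If `g` has period `T`, then `φ (T / n)` is the square of an automorphism, so it acts on each
coordinate by an increasing map whose `n`-th iterate fixes the coordinate of `g`. An increasing map
of the line has no other periodic points than fixed points, so each coordinate returns to its value
at all times `T / n`, and its derivative along the flow vanishes at `g`. The three differentials are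
independent, so the vector field vanishes at `g`, and `g` is a fixed point. -/

open Set Filter Topology VectorField

/-! ### Gluing local functions; closed forms in a frame -/

/-- On a simply connected, locally path connected space, a family of functions, defined near each
point and differing pairwise by locally constant functions, comes from one global function. -/
theorem exists_global_of_locally_const_sub {X A : Type*} [TopologicalSpace X]
    [SimplyConnectedSpace X] [LocallyPathConnectedSpace X] [AddCommGroup A]
    (U : X → Set X) (hU : ∀ i, IsOpen (U i)) (hmem : ∀ x, x ∈ U x) (f : X → X → A)
    (hf : ∀ i j, ∀ x ∈ U i ∩ U j, ∀ᶠ y in 𝓝 x, f i y - f j y = f i x - f j x) :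
    ∃ F : X → A, ∀ x, ∀ᶠ y in 𝓝 x, F y - f x y = F x - f x x := by
  let _ : TopologicalSpace A := ⊥
  have : DiscreteTopology A := ⟨rfl⟩
  -- The bundle of additive constants: its fibre is discrete, so it is a covering, and simple
  -- connectedness lifts the identity to a global section `σ`.
  let Z : FiberBundleCore X X A :=
    { baseSet := U
      isOpen_baseSet := hU
      indexAt := id
      mem_baseSet_at := hmem
      coordChange := fun i j x v => v + (f i x - f j x)
      coordChange_self := by simp
      continuousOn_coordChange := by
        rintro i j ⟨x, v⟩ ⟨hx, -⟩
        apply ContinuousAt.continuousWithinAt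
        refine continuousAt_snd.add (ContinuousAt.comp (f := Prod.fst)
          (g := fun x => f i x - f j x) ?_ continuousAt_fst)
        exact (continuousAt_const (y := f i x - f j x)).congr
          ((hf i j x hx).mono fun y hy => hy.symm)
      coordChange_comp := by
        intros
        abel }
  obtain ⟨x₀⟩ : Nonempty X := inferInstance
  have cov : IsCoveringMap (Bundle.TotalSpace.proj : Bundle.TotalSpace A Z.Fiber → X) :=
    IsFiberBundle.isCoveringMap (F := A) fun x => ⟨Z.localTrivAt x, hmem x⟩
  obtain ⟨σ, ⟨-, hσ⟩, -⟩ :=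
    cov.existsUnique_continuousMap_lifts
      (ContinuousMap.id X) x₀ ⟨x₀, (0 : A)⟩ rfl
  have hp : ∀ x, (σ x).proj = x := fun x => congrFun hσ x
  refine ⟨fun x => (show A from (σ x).snd) + f x x, fun x => ?_⟩
  have hc : ContinuousAt (fun y => (Z.localTrivAt x (σ y)).2) x := by
    refine continuousAt_snd.comp (ContinuousAt.comp (g := Z.localTrivAt x) ?_ σ.continuous.continuousAt)
    apply (Z.localTrivAt x).toOpenPartialHomeomorph.continuousAt
    show (σ x).proj ∈ U x
    rw [hp]; exact hmem x
  have hev : ∀ᶠ y in 𝓝 x, (Z.localTrivAt x (σ y)).2 = (Z.localTrivAt x (σ x)).2 := by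
    have := hc.tendsto
    rw [nhds_discrete A] at this
    exact this.eventually (p := fun a => a = (Z.localTrivAt x (σ x)).2) (mem_pure.2 rfl)
  -- In the trivialization at `x`, the section `σ` reads `F - f x`; being continuous into a discrete
  -- space, it is locally constant.
  have key : ∀ y, (Z.localTrivAt x (σ y)).2 = (show A from (σ y).snd) + (f y y - f x y) := by
    intro y
    rw [Z.localTrivAt_snd]
    show (show A from (σ y).snd) + (f (σ y).proj (σ y).proj - f x (σ y).proj) = _
    rw [hp]
  filter_upwards [hev] with y hy
  rw [key, key] at hy
  rw [add_sub_assoc, add_sub_assoc, hy]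

/-- Given a frame `B` on an open set of a vector space with structure constants
`⁅·,·⁆`, a `1`-form with components `h • α` in this frame is closed if
`α ⁅v, w⁆ = β v * α w - β w * α v` and `dh = h • β` in the frame. -/
theorem fderiv_symmetric_of_frame {V : Type*} [NormedAddCommGroup V] [NormedSpace ℝ V]
    {B : V → V →L[ℝ] V} {h : V → ℝ} {θ : V → V →L[ℝ] ℝ} {α β : V → ℝ} {br : V → V → V} {y : V}
    (hB : DifferentiableAt ℝ B y) (hBs : Function.Surjective (B y))
    (hh : DifferentiableAt ℝ h y) (hθ : DifferentiableAt ℝ θ y)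
    (hθB : ∀ᶠ x in 𝓝 y, ∀ v, θ x (B x v) = h x * α v)
    (hhB : ∀ v, fderiv ℝ h y (B y v) = h y * β v)
    (hbr : ∀ v w, VectorField.lieBracket ℝ (fun x => B x v) (fun x => B x w) y = B y (br v w))
    (hα : ∀ v w, α (br v w) = β v * α w - β w * α v) (a b : V) :
    fderiv ℝ θ y a b = fderiv ℝ θ y b a := by
  obtain ⟨v, rfl⟩ := hBs a
  obtain ⟨w, rfl⟩ := hBs b
  -- Differentiate `θ (B w) = h * α w` along `B v`; antisymmetrizing then brings in the bracket of
  -- the frame fields.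
  have key : ∀ v w, fderiv ℝ θ y (B y v) (B y w) + θ y (fderiv ℝ B y (B y v) w)
      = h y * β v * α w := by
    intro v w
    have e1 : (fun x => θ x (B x w)) =ᶠ[𝓝 y] fun x => h x * α w := by
      filter_upwards [hθB] with x hx using hx w
    have e2 : HasFDerivAt (fun x => B x w) ((fderiv ℝ B y).flip w) y := by
      simpa using hB.hasFDerivAt.clm_apply (hasFDerivAt_const w y)
    have e3 := (hθ.hasFDerivAt.clm_apply e2).congr_of_eventuallyEq e1.symm
    have e4 := e3.unique (hh.hasFDerivAt.mul_const (α w))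
    have e5 := congrArg (fun L => L (B y v)) e4
    simp [hhB] at e5
    linarith
  have hl := hbr v w
  have e2 : ∀ w, fderiv ℝ (fun x => B x w) y = (fderiv ℝ B y).flip w := fun w =>
    (by simpa using hB.hasFDerivAt.clm_apply (hasFDerivAt_const w y) :
      HasFDerivAt (fun x => B x w) ((fderiv ℝ B y).flip w) y).fderiv
  rw [VectorField.lieBracket, e2, e2] at hl
  have hl' := congrArg (θ y) hl
  rw [hθB.self_of_nhds, hα, map_sub] at hl'
  simp only [ContinuousLinearMap.flip_apply] at hl'
  have k1 := key v w
  have k2 := key w v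
  nlinarith

/-- A family of operators on a finite dimensional space that is pointwise differentiable is
differentiable. -/
theorem differentiableAt_of_differentiableAt_apply {V W : Type*} [NormedAddCommGroup V]
    [NormedSpace ℝ V] [NormedAddCommGroup W] [NormedSpace ℝ W] [FiniteDimensional ℝ V]
    {B : W → V →L[ℝ] V} {y : W}
    (hB : ∀ v, DifferentiableAt ℝ (fun x => B x v) y) : DifferentiableAt ℝ B y := by
  let b := Module.finBasis ℝ V
  have hb : B = fun x => ∑ i, ContinuousLinearMap.smulRightL ℝ V V
      (LinearMap.toContinuousLinearMap (b.coord i)) (B x (b i)) := by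
    funext x
    ext v
    conv_lhs => rw [← b.sum_repr v, map_sum]
    simp
  rw [hb]
  exact DifferentiableAt.fun_sum fun i _ =>
    (ContinuousLinearMap.differentiableAt _).comp y (hB (b i))

/-! ### Calculus along left-invariant vector fields -/

section LeftDerivatives

variable {V : Type*} [NormedAddCommGroup V] [NormedSpace ℝ V]
  {H : Type*} [TopologicalSpace H] {I : ModelWithCorners ℝ V H}
  {G : Type*} [TopologicalSpace G] [ChartedSpace H G] [Group G]

variable (I) in
/-- `f` is differentiable at `g`, with derivative `l v` along each left-invariant vector field. -/
def HasLeftDerivAt (f : G → ℝ) (l : GroupLieAlgebra I G → ℝ) (g : G) : Prop :=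
  ∃ f' : TangentSpace I g →L[ℝ] ℝ, HasMFDerivAt I 𝓘(ℝ, ℝ) f g f' ∧
    ∀ v, f' (mulInvariantVectorField v g) = l v

theorem HasLeftDerivAt.sub {f₁ f₂ : G → ℝ} {l₁ l₂ : GroupLieAlgebra I G → ℝ} {g : G}
    (h₁ : HasLeftDerivAt I f₁ l₁ g) (h₂ : HasLeftDerivAt I f₂ l₂ g) :
    HasLeftDerivAt I (fun x => f₁ x - f₂ x) (fun v => l₁ v - l₂ v) g := by
  obtain ⟨a, ha, ha'⟩ := h₁
  obtain ⟨b, hb, hb'⟩ := h₂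
  refine ⟨a - b, ha.sub hb, fun v => ?_⟩
  rw [sub_apply, ha', hb']

theorem HasLeftDerivAt.scomp {f : G → ℝ} {l : GroupLieAlgebra I G → ℝ} {g : G} {u : ℝ → ℝ}
    {u' : ℝ} (hu : HasDerivAt u u' (f g)) (h : HasLeftDerivAt I f l g) :
    HasLeftDerivAt I (fun x => u (f x)) (fun v => u' * l v) g := by
  obtain ⟨a, ha, ha'⟩ := h
  refine ⟨_, (hu.hasFDerivAt.hasMFDerivAt).comp g ha, fun v => ?_⟩
  have : (((ContinuousLinearMap.toSpanSingleton ℝ u') : ℝ →L[ℝ] ℝ).comp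
    (a : TangentSpace I g →L[ℝ] ℝ)) (mulInvariantVectorField v g) = u' * l v := by
    simp [ha', mul_comm]
  exact this

theorem HasLeftDerivAt.congr_of_eventuallyEq {f f₁ : G → ℝ} {l : GroupLieAlgebra I G → ℝ} {g : G}
    (h : HasLeftDerivAt I f l g) (hf : f₁ =ᶠ[𝓝 g] f) : HasLeftDerivAt I f₁ l g :=
  let ⟨a, ha, ha'⟩ := h
  ⟨a, ha.congr_of_eventuallyEq hf, ha'⟩

theorem HasLeftDerivAt.add_const {f : G → ℝ} {l : GroupLieAlgebra I G → ℝ} {g : G}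
    (h : HasLeftDerivAt I f l g) (c : ℝ) : HasLeftDerivAt I (fun x => f x + c) l g := by
  simpa using h.scomp (u := fun y => y + c) ((hasDerivAt_id _).add_const c)

variable [LieGroup I ∞ G]

theorem mulInvariantVectorField_bijective [FiniteDimensional ℝ V] (g : G) :
    Function.Bijective (fun v : GroupLieAlgebra I G => mulInvariantVectorField v g) := by
  have hd : ∀ a x : G, MDifferentiableAt I I (a * ·) x := fun a x =>
    (contMDiff_mul_left (I := I) (n := ∞)).contMDiffAt.mdifferentiableAt (by simp)
  have key : (mfderiv I I (g⁻¹ * ·) (g * 1)).comp (mfderiv I I (g * ·) (1 : G))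
      = ContinuousLinearMap.id ℝ (TangentSpace I (1 : G)) := by
    have : (g⁻¹ * ·) ∘ (g * ·) = (id : G → G) := by
      funext y; simp
    rw [← mfderiv_comp (1 : G) (hd _ _) (hd _ _), this, mfderiv_id]
  have hinj : Function.Injective (mfderiv I I (g * ·) (1 : G)) :=
    Function.LeftInverse.injective fun v => congrArg (fun L => L v) key
  let f : V →ₗ[ℝ] V := ContinuousLinearMap.toLinearMap (mfderiv I I (g * ·) (1 : G))
  have hf : Function.Injective f := hinj
  have hs : Function.Surjective f := LinearMap.injective_iff_surjective.1 hf
  exact ⟨hinj, hs⟩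

/-! ### The left-invariant frame in a chart; primitives of closed forms -/

section Chart

theorem locallyPathConnectedSpace_of_boundaryless (I : ModelWithCorners ℝ V H) [I.Boundaryless]
    (G : Type*) [TopologicalSpace G] [ChartedSpace H G] : LocallyPathConnectedSpace G := by
  have : LocallyPathConnectedSpace H := I.toHomeomorph.isOpenEmbedding.locallyPathConnectedSpace
  exact ChartedSpace.locallyPathConnectedSpace H G

variable [I.Boundaryless]

theorem contMDiffAt_extChartAt_symm_of_mem {x₀ : G} {y : V} (hy : y ∈ (extChartAt I x₀).target) :
    ContMDiffAt 𝓘(ℝ, V) I ∞ (extChartAt I x₀).symm y := by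
  have : IsManifold I ∞ G := inferInstance
  exact (contMDiffOn_extChartAt_symm x₀).contMDiffAt ((isOpen_extChartAt_target x₀).mem_nhds hy)

theorem isInvertible_mfderiv_extChartAt_symm {x₀ : G} {y : V}
    (hy : y ∈ (extChartAt I x₀).target) :
    (mfderiv 𝓘(ℝ, V) I (extChartAt I x₀).symm y).IsInvertible := by
  have : IsManifold I 1 G := IsManifold.of_le (n := ∞) (by simp)
  have h := isInvertible_mfderivWithin_extChartAt_symm hy
  rwa [I.range_eq_univ, mfderivWithin_univ] at h

variable (I) in
/-- The frame of left-invariant vector fields, read in the preferred chart at `x₀`. -/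
noncomputable def chartFrame (x₀ : G) (y : V) : V →L[ℝ] V :=
  ContinuousLinearMap.comp (M₁ := V) (M₂ := V) (M₃ := V)
    (mfderiv 𝓘(ℝ, V) I (extChartAt I x₀).symm y).inverse
    (mfderiv I I ((extChartAt I x₀).symm y * ·) (1 : G))

theorem mfderiv_symm_chartFrame {x₀ : G} {y : V} (hy : y ∈ (extChartAt I x₀).target)
    (v : GroupLieAlgebra I G) :
    mfderiv 𝓘(ℝ, V) I (extChartAt I x₀).symm y (chartFrame I x₀ y v) =
      mulInvariantVectorField v ((extChartAt I x₀).symm y) := by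
  obtain ⟨L, hL⟩ : ∃ L : V ≃L[ℝ] V,
      (L : V →L[ℝ] V) = mfderiv 𝓘(ℝ, V) I (extChartAt I x₀).symm y :=
    isInvertible_mfderiv_extChartAt_symm hy
  have h : chartFrame I x₀ y v = L.symm (mulInvariantVectorField v ((extChartAt I x₀).symm y)) := by
    have := congrArg (fun K : V →L[ℝ] V => K (mulInvariantVectorField v ((extChartAt I x₀).symm y)))
      (congrArg ContinuousLinearMap.inverse hL.symm)
    exact this.trans (congrArg (fun K : V →L[ℝ] V =>
      K (mulInvariantVectorField v ((extChartAt I x₀).symm y)))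
      (ContinuousLinearMap.inverse_equiv L))
  rw [h]
  exact (congrArg (fun K : V →L[ℝ] V => K (L.symm _)) hL.symm).trans (L.apply_symm_apply _)

variable [FiniteDimensional ℝ V]

theorem chartFrame_surjective {x₀ : G} {y : V} (hy : y ∈ (extChartAt I x₀).target) :
    Function.Surjective (chartFrame I x₀ y) := by
  have h := isInvertible_mfderiv_extChartAt_symm (I := I) hy
  obtain ⟨e, he⟩ := h
  have h1 : Function.Surjective (mfderiv 𝓘(ℝ, V) I (extChartAt I x₀).symm y).inverse := by
    rw [← he, ContinuousLinearMap.inverse_equiv]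
    exact e.symm.surjective
  exact h1.comp (mulInvariantVectorField_bijective (I := I) _).2

theorem differentiableAt_chartFrame {x₀ : G} {y : V} (hy : y ∈ (extChartAt I x₀).target) :
    DifferentiableAt ℝ (chartFrame I x₀) y := by
  have : IsManifold I 2 G := IsManifold.of_le (n := ∞) ENat.LEInfty.out
  refine differentiableAt_of_differentiableAt_apply fun v => ?_
  apply MDifferentiableAt.differentiableAt
  have h := MDifferentiableAt.mpullback_vectorField
    (mdifferentiableAt_mulInvariantVectorField (I := I) (G := G) v)
    ((contMDiffAt_extChartAt_symm_of_mem hy).of_le (m := 2) ENat.LEInfty.out)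
    (isInvertible_mfderiv_extChartAt_symm hy) le_rfl
  exact (contMDiff_snd_tangentBundle_modelSpace V 𝓘(ℝ, V)).contMDiffAt.mdifferentiableAt one_ne_zero
    |>.comp _ h

variable [CompleteSpace V]

/-- Pullback by the inverse chart commutes with brackets, and left-invariant fields are closed under
them, so the frame has constant structure coefficients. -/
theorem lieBracket_chartFrame {x₀ : G} {y : V} (hy : y ∈ (extChartAt I x₀).target)
    (v w : GroupLieAlgebra I G) :
    lieBracket ℝ (fun x => chartFrame I x₀ x v) (fun x => chartFrame I x₀ x w) y =
      chartFrame I x₀ y (⁅v, w⁆ : GroupLieAlgebra I G) := by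
  have : IsManifold I (minSmoothness ℝ 3) G := inferInstance
  have h := mpullback_mlieBracket (n := ∞)
    (mdifferentiableAt_mulInvariantVectorField (I := I) (G := G) v)
    (mdifferentiableAt_mulInvariantVectorField (I := I) (G := G) w)
    (contMDiffAt_extChartAt_symm_of_mem hy) (by simpa using! ENat.LEInfty.out)
  rw [← mulInvariantVector_mlieBracket] at h
  have e : ∀ A B : (x : V) → TangentSpace 𝓘(ℝ, V) x, mlieBracket 𝓘(ℝ, V) A B y = lieBracket ℝ A B y := fun A B => by
    rw [← mlieBracketWithin_univ, mlieBracketWithin_eq_lieBracketWithin]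
    exact congrFun lieBracketWithin_univ y
  exact ((e _ _).symm.trans h.symm)

/-- A function with vanishing derivative is locally constant. -/
theorem eventually_eq_of_hasLeftDerivAt_zero {f : G → ℝ} {x : G}
    (hf : ∀ᶠ g in 𝓝 x, HasLeftDerivAt I f (fun _ => 0) g) : ∀ᶠ g in 𝓝 x, f g = f x := by
  have hx := mem_extChartAt_source (I := I) x
  have hc := continuousAt_extChartAt_symm (I := I) x
  have h1 : ∀ᶠ y in 𝓝 (extChartAt I x x), y ∈ (extChartAt I x).target ∧
      HasLeftDerivAt I f (fun _ => 0) ((extChartAt I x).symm y) := by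
    refine Filter.Eventually.and (extChartAt_target_mem_nhds x) (hc.eventually ?_)
    rwa [extChartAt_to_inv]
  obtain ⟨ε, hε, hball⟩ := Metric.eventually_nhds_iff_ball.1 h1
  have hd : ∀ y ∈ Metric.ball (extChartAt I x x) ε,
      HasFDerivAt (f ∘ (extChartAt I x).symm) (0 : V →L[ℝ] ℝ) y := by
    intro y hy
    obtain ⟨hyt, f', hf', hf0⟩ := hball y hy
    have h0 : f' = 0 := by
      ext v
      obtain ⟨w, rfl⟩ := (mulInvariantVectorField_bijective (I := I) _).2 v
      exact hf0 w
    subst h0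
    have h2 := HasMFDerivAt.comp y hf'
      ((contMDiffAt_extChartAt_symm_of_mem hyt).mdifferentiableAt (by simp)).hasMFDerivAt
    refine hasMFDerivAt_iff_hasFDerivAt.1 (h2.congr_mfderiv ?_)
    exact ContinuousLinearMap.zero_comp _
  have hconst : ∀ y ∈ Metric.ball (extChartAt I x x) ε,
      f ((extChartAt I x).symm y) = f x := by
    intro y hy
    have := (convex_ball (extChartAt I x x) ε).is_const_of_fderivWithin_eq_zero (𝕜 := ℝ)
      (f := f ∘ (extChartAt I x).symm)
      (fun z hz => (hd z hz).differentiableAt.differentiableWithinAt)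
      (fun z hz => (hd z hz).hasFDerivWithinAt.fderivWithin
        (Metric.isOpen_ball.uniqueDiffWithinAt hz)) hy (Metric.mem_ball_self hε)
    simpa using this
  filter_upwards [extChartAt_source_mem_nhds (I := I) x,
    (continuousAt_extChartAt (I := I) x).eventually (Metric.ball_mem_nhds _ hε)] with g hg hgb
  simpa only [(extChartAt I x).left_inv hg] using hconst _ hgb

/-- A function with vanishing derivative on a connected Lie group is constant. -/
theorem eq_of_hasLeftDerivAt_zero [PreconnectedSpace G] {f : G → ℝ}
    (hf : ∀ g, HasLeftDerivAt I f (fun _ => 0) g) (x y : G) : f x = f y :=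
  IsLocallyConstant.apply_eq_of_preconnectedSpace
    ((IsLocallyConstant.iff_eventually_eq f).2 fun _ =>
      eventually_eq_of_hasLeftDerivAt_zero (.of_forall hf)) x y

/-- The form with components `h • α` in the left-invariant frame has local primitives if it is
closed. -/
theorem exists_local_primitive {h : G → ℝ} {α β : GroupLieAlgebra I G →ₗ[ℝ] ℝ}
    (hα : ∀ v w, α ⁅v, w⁆ = β v * α w - β w * α v)
    (hh : ∀ g, HasLeftDerivAt I h (fun v => h g * β v) g) (x : G) :
    ∃ (U : Set G) (f : G → ℝ), IsOpen U ∧ x ∈ U ∧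
      ∀ g ∈ U, HasLeftDerivAt I f (fun v => h g * α v) g := by
  let e := extChartAt I x
  let hc : V → ℝ := fun y => h (e.symm y)
  let α₀ : V →ₗ[ℝ] ℝ := α
  let α' : V →L[ℝ] ℝ := LinearMap.toContinuousLinearMap α₀
  let θ : V → V →L[ℝ] ℝ := fun y => hc y • α'.comp (chartFrame I x y).inverse
  have hopen : IsOpen e.target := isOpen_extChartAt_target x
  have hinv : ∀ y ∈ e.target, (chartFrame I x y).IsInvertible := by
    intro y hy
    have hs := chartFrame_surjective hy
    refine ⟨(LinearEquiv.ofBijective (chartFrame I x y).toLinearMap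
      ⟨LinearMap.injective_iff_surjective.2 hs, hs⟩).toContinuousLinearEquiv, ?_⟩
    ext v
    rfl
  have hhc : ∀ y ∈ e.target, DifferentiableAt ℝ hc y ∧
      ∀ v, fderiv ℝ hc y (chartFrame I x y v) = hc y * β v := by
    intro y hy
    obtain ⟨h', hh', hv⟩ := hh (e.symm y)
    have h2 := HasMFDerivAt.comp y hh'
      ((contMDiffAt_extChartAt_symm_of_mem hy).mdifferentiableAt (by simp)).hasMFDerivAt
    obtain ⟨D, hD, hDv⟩ : ∃ D : V →L[ℝ] ℝ, HasFDerivAt hc D y ∧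
        ∀ w : V, D w = h' (mfderiv 𝓘(ℝ, V) I (extChartAt I x).symm y w) :=
      ⟨_, hasMFDerivAt_iff_hasFDerivAt.1 h2, fun _ => rfl⟩
    refine ⟨hD.differentiableAt, fun v => ?_⟩
    rw [hD.fderiv, hDv]
    exact (congrArg h' (mfderiv_symm_chartFrame hy v)).trans (hv v)
  have hθB : ∀ y ∈ e.target, ∀ v, θ y (chartFrame I x y v) = hc y * α v := by
    intro y hy v
    simp only [θ, smul_apply, ContinuousLinearMap.comp_apply, smul_eq_mul]
    exact congrArg (fun w => hc y * α w) ((hinv y hy).inverse_apply_self v)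
  have hθd : ∀ y ∈ e.target, DifferentiableAt ℝ θ y := by
    intro y hy
    refine (hhc y hy).1.smul ?_
    have h5 : DifferentiableAt ℝ (fun z => (chartFrame I x z).inverse) y :=
      ((hinv y hy).contDiffAt_map_inverse (n := 1)).differentiableAt one_ne_zero
        |>.comp y (differentiableAt_chartFrame hy)
    exact (differentiableAt_const _).clm_comp h5
  -- Poincaré lemma on a ball inside the chart: `θ`, the form `h • α` read in the chart, has
  -- symmetric derivative there.
  obtain ⟨ε, hε, hball⟩ := Metric.isOpen_iff.1 hopen _ (mem_extChartAt_target x)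
  obtain ⟨F, hF⟩ := (convex_ball (extChartAt I x x) ε).exists_forall_hasFDerivAt_of_fderiv_symmetric
    Metric.isOpen_ball (fun y hy => (hθd y (hball hy)).differentiableWithinAt)
    (fun y hy => fderiv_symmetric_of_frame (differentiableAt_chartFrame (hball hy))
      (chartFrame_surjective (hball hy)) (hhc y (hball hy)).1 (hθd y (hball hy))
      (Filter.mem_of_superset (hopen.mem_nhds (hball hy)) fun z hz => hθB z hz) (hhc y (hball hy)).2
      (lieBracket_chartFrame (hball hy)) hα)
  refine ⟨e.source ∩ e ⁻¹' Metric.ball (extChartAt I x x) ε, F ∘ e,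
    (continuousOn_extChartAt x).isOpen_inter_preimage (isOpen_extChartAt_source x)
      Metric.isOpen_ball, ⟨mem_extChartAt_source x, Metric.mem_ball_self hε⟩, ?_⟩
  rintro g ⟨hg, hgb⟩
  have : IsManifold I 1 G := IsManifold.of_le (n := ∞) (by simp)
  have hm := (mdifferentiableAt_extChartAt (I := I) (x := x) (y := g) ((extChartAt_source I x) ▸ hg)).hasMFDerivAt
  refine ⟨_, HasMFDerivAt.comp g (hF _ hgb).hasMFDerivAt hm, fun v => ?_⟩
  have h6 := hθB (e g) (hball hgb) v
  have h7 : hc (e g) = h g := congrArg h (e.left_inv hg)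
  -- The differential of the chart carries left-invariant fields to the frame; checked after
  -- applying the differential `L` of the inverse chart.
  have h8 : (mfderiv I 𝓘(ℝ, V) (extChartAt I x) g (mulInvariantVectorField v g) : V)
      = chartFrame I x (e g) v := by
    obtain ⟨L, hL⟩ := isInvertible_mfderiv_extChartAt_symm (I := I) (hball hgb)
    apply L.injective
    have h9 := mfderivWithin_extChartAt_symm_comp_mfderiv_extChartAt' (I := I) hg
    rw [I.range_eq_univ, mfderivWithin_univ] at h9
    have h10 := congrArg (fun K => K (mulInvariantVectorField v g)) h9
    have h11 := mfderiv_symm_chartFrame (I := I) (hball hgb) v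
    have h12 : (mulInvariantVectorField v (e.symm (e g)) : V) = mulInvariantVectorField v g :=
      congrArg (fun k => (mulInvariantVectorField (I := I) v k : V)) (e.left_inv hg)
    have h13 : ∀ w : V, L w = mfderiv 𝓘(ℝ, V) I (extChartAt I x).symm (e g) w := fun w =>
      congrArg (fun K => K w) hL
    exact (h13 _).trans (h10.trans (h12.symm.trans (h11.symm.trans (h13 _).symm)))
  exact (congrArg (θ (e g)) h8).trans (h6.trans (congrArg (· * α v) h7))

/-- On a simply connected Lie group, a closed form `h • α` with `α` left-invariant is exact. -/
theorem exists_primitive [SimplyConnectedSpace G] {h : G → ℝ}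
    {α β : GroupLieAlgebra I G →ₗ[ℝ] ℝ} (hα : ∀ v w, α ⁅v, w⁆ = β v * α w - β w * α v)
    (hh : ∀ g, HasLeftDerivAt I h (fun v => h g * β v) g) :
    ∃ f : G → ℝ, f 1 = 0 ∧ ∀ g, HasLeftDerivAt I f (fun v => h g * α v) g := by
  have := locallyPathConnectedSpace_of_boundaryless I G
  choose U f hU hmem hf using exists_local_primitive hα hh
  obtain ⟨F, hF⟩ := exists_global_of_locally_const_sub U hU hmem f (by
    rintro i j x ⟨hi, hj⟩
    refine eventually_eq_of_hasLeftDerivAt_zero (I := I) (f := fun y => f i y - f j y) ?_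
    filter_upwards [(hU i).mem_nhds hi, (hU j).mem_nhds hj] with g hgi hgj
    simpa using (hf i g hgi).sub (hf j g hgj))
  refine ⟨fun x => F x + -F 1, by simp, fun g => HasLeftDerivAt.add_const ?_ _⟩
  refine ((hf g g (hmem g)).add_const (F g - f g g)).congr_of_eventuallyEq ?_
  filter_upwards [hF g] with y hy
  rw [← hy]; ring

end Chart

end LeftDerivatives

/-! ### Adapted bases, derivations and injective endomorphisms -/

section AdaptedBases

section

attribute [local instance 100] LieRing.ofAssociativeRing

/-- Coordinates on `𝔤_{2,1} ⊕ 𝔤_1` whose associated basis is adapted. -/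
noncomputable def affProdCoords : (affLie × ℝ) ≃ₗ[ℝ] (Fin 3 → ℝ) where
  -- With matrix units `e₁₁`, `e₁₂`, the basis is `E 0 = (e₁₂/2, 1/2)`, `E 1 = (-e₁₂/2, 1/2)`, `E 2
  -- = (2 e₁₁, 0)`. Thus `E 0 - E 1` is `e₁₂`, an eigenvector of `ad (E 2)` for the eigenvalue 2,
  -- and `E 0 + E 1` is central.
  toFun p := ![p.1.1 0 1 + p.2, p.2 - p.1.1 0 1, p.1.1 0 0 / 2]
  map_add' p q := by
    ext i
    fin_cases i <;> simp <;> ring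
  map_smul' c p := by
    ext i
    fin_cases i <;> simp <;> ring
  invFun c := (⟨!![2 * c 2, (c 0 - c 1) / 2; 0, 0], fun j => by fin_cases j <;> rfl⟩,
    (c 0 + c 1) / 2)
  left_inv p := by
    refine Prod.ext (Subtype.ext ?_) ?_
    · ext i j
      have := p.1.2
      fin_cases i <;> fin_cases j <;> simp [this 0, this 1] <;> ring
    · simp only [Matrix.cons_val_zero, Matrix.cons_val_one]
      ring
  right_inv c := by
    ext i
    fin_cases i <;> simp <;> ring

theorem exists_isAdaptedBasis {L : Type*} [LieRing L] [LieAlgebra ℝ L] (hL : IsTypeG21G1 L) :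
    ∃ E : Module.Basis (Fin 3) ℝ L, IsAdaptedBasis E := by
  obtain ⟨e⟩ := hL
  let E : Module.Basis (Fin 3) ℝ L := Module.Basis.ofEquivFun (e.toLinearEquiv.trans affProdCoords)
  have hE : ∀ i, e (E i) = affProdCoords.symm (Pi.single i 1) := by
    intro i
    simp only [E, Module.Basis.coe_ofEquivFun]
    exact e.apply_symm_apply _
  have key : ∀ x y : L, e x = e y → x = y := fun x y h => e.injective h
  refine ⟨E, ⟨key _ _ ?_, key _ _ ?_, key _ _ ?_⟩⟩ <;>
  · simp only [LieEquiv.map_lie, map_sub, map_zero, hE]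
    refine Prod.ext (Subtype.ext ?_) ?_
    · ext i j
      fin_cases i <;> fin_cases j <;>
        simp [affProdCoords, Ring.lie_def] <;> norm_num
    · simp [affProdCoords, Ring.lie_def]

end

variable {L : Type*} [LieRing L] [LieAlgebra ℝ L] {E : Module.Basis (Fin 3) ℝ L}

theorem IsAdaptedBasis.lie_eq (hE : IsAdaptedBasis E) (v w : L) :
    ⁅v, w⁆ = (E.repr v 2 * (E.repr w 0 - E.repr w 1) - (E.repr v 0 - E.repr v 1) * E.repr w 2) •
      (E 0 - E 1) := by
  have h10 : ⁅E 1, E 0⁆ = 0 := by rw [← lie_skew, hE.lie_12, neg_zero]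
  have h02 : ⁅E 0, E 2⁆ = -(E 0 - E 1) := by rw [← lie_skew, hE.lie_31]
  have h21 : ⁅E 2, E 1⁆ = -(E 0 - E 1) := by rw [← lie_skew, hE.lie_23]
  conv_lhs => rw [← E.sum_repr v, ← E.sum_repr w]
  simp only [Fin.sum_univ_three, lie_add, add_lie, lie_smul, smul_lie, lie_self, hE.lie_12,
    hE.lie_31, hE.lie_23, h10, h02, h21]
  module

theorem IsAdaptedBasis.repr_lie_zero (hE : IsAdaptedBasis E) (v w : L) :
    E.repr ⁅v, w⁆ 0 =
      E.repr v 2 * (E.repr w 0 - E.repr w 1) - (E.repr v 0 - E.repr v 1) * E.repr w 2 := by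
  simp [hE.lie_eq v w]

theorem IsAdaptedBasis.repr_lie_one (hE : IsAdaptedBasis E) (v w : L) :
    E.repr ⁅v, w⁆ 1 =
      -(E.repr v 2 * (E.repr w 0 - E.repr w 1) - (E.repr v 0 - E.repr v 1) * E.repr w 2) := by
  simp [hE.lie_eq v w]

theorem IsAdaptedBasis.repr_lie_two (hE : IsAdaptedBasis E) (v w : L) :
    E.repr ⁅v, w⁆ 2 = 0 := by
  simp [hE.lie_eq v w]

/-- Brackets have no `E 2` component, so `D (E 0)` and `D (E 1)` have equal ones; the relation `⁅E
0, E 1⁆ = 0` makes their sum zero. The coordinates of the other two relations give the rest. -/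
theorem IsAdaptedBasis.toMatrix_derivation (hE : IsAdaptedBasis E) (D : LieDerivation ℝ L L) :
    ∃ x₁ x₂ x₃ y₃ : ℝ, LinearMap.toMatrix E E (D : L →ₗ[ℝ] L) =
      !![x₁, x₂, x₃; x₂, x₁, y₃; 0, 0, 0] := by
  have h12 := D.apply_lie_eq_sub (E 0) (E 1)
  have h31 := D.apply_lie_eq_sub (E 2) (E 0)
  have h23 := D.apply_lie_eq_sub (E 1) (E 2)
  rw [hE.lie_12, map_zero] at h12
  rw [hE.lie_31, map_sub] at h31
  rw [hE.lie_23, map_sub] at h23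
  have c := fun (x y : L) (h : x = y) (i : Fin 3) => congrArg (fun v => E.repr v i) h
  have a0 := c _ _ h12 0
  have b0 := c _ _ h31 0
  have b1 := c _ _ h31 1
  have b2 := c _ _ h31 2
  have d0 := c _ _ h23 0
  have d1 := c _ _ h23 1
  have d2 := c _ _ h23 2
  simp [hE.repr_lie_zero, hE.repr_lie_one, hE.repr_lie_two] at a0 b0 b1 b2 d0 d1 d2
  refine ⟨E.repr (D (E 0)) 0, E.repr (D (E 1)) 0, E.repr (D (E 2)) 0, E.repr (D (E 2)) 1, ?_⟩
  ext i j
  fin_cases i <;> fin_cases j <;> simp [LinearMap.toMatrix_apply] <;> linarith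

theorem charpoly_of_derivation_matrix (x₁ x₂ x₃ y₃ : ℝ) :
    (!![x₁, x₂, x₃; x₂, x₁, y₃; 0, 0, 0] : Matrix (Fin 3) (Fin 3) ℝ).charpoly =
      Polynomial.X * ((Polynomial.X - Polynomial.C (x₁ - x₂)) *
        (Polynomial.X - Polynomial.C (x₁ + x₂))) := by
  simp [Matrix.charpoly, Matrix.det_fin_three]
  ring

theorem IsAdaptedBasis.derivation (hE : IsAdaptedBasis E) (D : LieDerivation ℝ L L) :
    ∃ x₁ x₂ x₃ y₃ : ℝ,
      LinearMap.toMatrix E E (D : L →ₗ[ℝ] L) = !![x₁, x₂, x₃; x₂, x₁, y₃; 0, 0, 0] ∧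
      (∀ μ : ℂ, Module.End.HasEigenvalue ((D : L →ₗ[ℝ] L).baseChange ℂ) μ ↔
        μ = 0 ∨ μ = ((x₁ - x₂ : ℝ) : ℂ) ∨ μ = ((x₁ + x₂ : ℝ) : ℂ)) ∧
      (LinearMap.toMatrix E E (D : L →ₗ[ℝ] L)).charpoly.aroots ℂ =
        {0, ((x₁ - x₂ : ℝ) : ℂ), ((x₁ + x₂ : ℝ) : ℂ)} := by
  obtain ⟨x₁, x₂, x₃, y₃, h⟩ := hE.toMatrix_derivation D
  have : Module.Finite ℝ L := Module.Finite.of_basis E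
  have : Module.Free ℝ L := Module.Free.of_basis E
  refine ⟨x₁, x₂, x₃, y₃, h, fun μ => ?_, ?_⟩
  · rw [Module.End.hasEigenvalue_iff_isRoot_charpoly, LinearMap.charpoly_baseChange,
      ← LinearMap.charpoly_toMatrix (D : L →ₗ[ℝ] L) E, h, charpoly_of_derivation_matrix]
    simp [sub_eq_zero]
  · rw [h, charpoly_of_derivation_matrix]
    have h1 := Polynomial.X_sub_C_ne_zero (x₁ - x₂)
    have h2 := Polynomial.X_sub_C_ne_zero (x₁ + x₂)
    rw [Polynomial.aroots_mul (mul_ne_zero Polynomial.X_ne_zero (mul_ne_zero h1 h2)),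
      Polynomial.aroots_mul (mul_ne_zero h1 h2), Polynomial.aroots_X, Polynomial.aroots_X_sub_C,
      Polynomial.aroots_X_sub_C]
    rfl

/-- An injective endomorphism, in coordinates dual to `E 0 - E 1`, `E 0 + E 1`, `E 2`. -/
theorem IsAdaptedBasis.repr_endomorphism (hE : IsAdaptedBasis E) {A : L →ₗ[ℝ] L}
    (hA : Function.Injective A) (hlie : ∀ v w, A ⁅v, w⁆ = ⁅A v, A w⁆) :
    ∃ p q a b : ℝ, p ≠ 0 ∧ q ≠ 0 ∧ ∀ v,
      E.repr (A v) 2 = E.repr v 2 ∧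
      E.repr (A v) 0 - E.repr (A v) 1 = p * (E.repr v 0 - E.repr v 1) + a * E.repr v 2 ∧
      E.repr (A v) 0 + E.repr (A v) 1 = q * (E.repr v 0 + E.repr v 1) + b * E.repr v 2 := by
  have c := fun (x y : L) (i : Fin 3) => congrArg (fun v => E.repr v i) (hlie x y)
  have hn : (2 : ℝ) • (E 0 - E 1) = ⁅E 2, E 0 - E 1⁆ := by
    rw [hE.lie_eq]; simp; norm_num
  have hz : ⁅E 2, E 0 + E 1⁆ = 0 := by
    rw [hE.lie_eq]; simp
  have hnz : ⁅E 0 - E 1, E 0 + E 1⁆ = 0 := by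
    rw [hE.lie_eq]; simp
  have a0 := c (E 2) (E 0 - E 1) 0
  have a1 := c (E 2) (E 0 - E 1) 1
  have a2 := c (E 2) (E 0 - E 1) 2
  have b0 := c (E 2) (E 0 + E 1) 0
  have d0 := c (E 0 - E 1) (E 0 + E 1) 0
  rw [← hn] at a0 a1 a2
  rw [hz] at b0
  rw [hnz] at d0
  simp only [hE.repr_lie_zero, hE.repr_lie_one, hE.repr_lie_two, map_smul, map_zero,
    Finsupp.smul_apply, smul_eq_mul, Finsupp.zero_apply] at a0 a1 a2 b0 d0
  set N := A (E 0 - E 1) with hN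
  set Z := A (E 0 + E 1) with hZ
  set P := A (E 2) with hP
  have n2 : E.repr N 2 = 0 := by linarith
  have n1 : E.repr N 1 = -E.repr N 0 := by linarith
  have ext3 : ∀ v : L, E.repr v 0 = 0 → E.repr v 1 = 0 → E.repr v 2 = 0 → v = 0 := by
    intro v h0 h1 h2
    apply E.repr.injective
    ext i
    fin_cases i <;> simp [h0, h1, h2]
  have n0 : E.repr N 0 ≠ 0 := by
    intro h
    have h0 : A (E 0 - E 1) = A 0 := by rw [map_zero A]; exact ext3 N h (by rw [n1, h, neg_zero]) n2
    have := congrArg (fun v => E.repr v 0) (hA h0)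
    simp at this
  -- `N` is a nonzero multiple of `E 0 - E 1`, and applying `A` to the eigenvector relation gives `2
  -- N = ⁅P, N⁆ = 2 P₂ N`.
  have p2 : E.repr P 2 = 1 := by
    rw [n1, n2] at a0
    apply mul_right_cancel₀ n0
    linarith
  -- `Z` commutes with `N` and with `P`, which forces it into the centre, the line of `E 0 + E 1`.
  have z2 : E.repr Z 2 = 0 := by
    rw [n1, n2] at d0
    have : E.repr N 0 * E.repr Z 2 = 0 := by linarith
    exact (mul_eq_zero.1 this).resolve_left n0
  have z1 : E.repr Z 1 = E.repr Z 0 := by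
    rw [p2, z2] at b0
    linarith
  have z0 : E.repr Z 0 ≠ 0 := by
    intro h
    have h0 : A (E 0 + E 1) = A 0 := by rw [map_zero A]; exact ext3 Z h (by rw [z1, h]) z2
    have := congrArg (fun v => E.repr v 0) (hA h0)
    simp at this
  have hv : ∀ v, A v = ((E.repr v 0 - E.repr v 1) / 2) • N + ((E.repr v 0 + E.repr v 1) / 2) • Z +
      E.repr v 2 • P := by
    intro v
    conv_lhs => rw [← E.sum_repr v]
    simp only [Fin.sum_univ_three, hN, hZ, hP, map_add, map_sub, map_smul]
    module
  refine ⟨E.repr N 0, E.repr Z 0, E.repr P 0 - E.repr P 1, E.repr P 0 + E.repr P 1, n0, z0,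
    fun v => ?_⟩
  simp only [hv v, map_add, map_smul, Finsupp.add_apply, Finsupp.smul_apply, smul_eq_mul, n2, n1,
    z2, z1, p2]
  refine ⟨by ring, by ring, by ring⟩

end AdaptedBases

/-! ### Automorphisms of the group and their differentials at the identity -/

section Automorphisms

variable {V : Type*} [NormedAddCommGroup V] [NormedSpace ℝ V]
  {H : Type*} [TopologicalSpace H] {I : ModelWithCorners ℝ V H}
  {G : Type*} [TopologicalSpace G] [ChartedSpace H G] [Group G] {ψ : G → G}

theorem IsLieGroupAut.map_one (hψ : IsLieGroupAut I ψ) : ψ 1 = 1 := by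
  simpa using hψ.1 1 1

theorem IsLieGroupAut.contMDiff (hψ : IsLieGroupAut I ψ) : ContMDiff I I ∞ ψ := by
  obtain ⟨-, Φ, rfl⟩ := hψ
  exact Φ.contMDiff

theorem IsLieGroupAut.isInvertible_mfderiv (hψ : IsLieGroupAut I ψ) (g : G) :
    (mfderiv I I ψ g).IsInvertible := by
  obtain ⟨-, Φ, rfl⟩ := hψ
  exact ⟨Φ.mfderivToContinuousLinearEquiv (by simp) g, Φ.mfderivToContinuousLinearEquiv_coe (by simp)⟩

variable (I) in
/-- The derivative at the identity of a map fixing it. -/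
noncomputable def mfderivOne (ψ : G → G) : GroupLieAlgebra I G →ₗ[ℝ] GroupLieAlgebra I G :=
  show V →ₗ[ℝ] V from ContinuousLinearMap.toLinearMap (mfderiv I I ψ (1 : G))

theorem mfderivOne_injective (hψ : IsLieGroupAut I ψ) : Function.Injective (mfderivOne I ψ) := by
  obtain ⟨e, he⟩ := hψ.isInvertible_mfderiv (1 : G)
  intro v w h
  apply e.injective
  have h13 : ∀ w, e w = mfderiv I I ψ (1 : G) w := fun w => congrArg (fun K => K w) he
  exact (h13 v).trans (Eq.trans h (h13 w).symm)

variable [LieGroup I ∞ G]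

/-- Differentiate at the identity the relation saying that `ψ` after left translation by `g` is left
translation by `ψ g` after `ψ`. -/
theorem mfderiv_mulInvariantVectorField (hψ : IsLieGroupAut I ψ) (g : G)
    (v : GroupLieAlgebra I G) :
    mfderiv I I ψ g (mulInvariantVectorField v g) =
      mulInvariantVectorField (mfderivOne I ψ v) (ψ g) := by
  have hd : ∀ a x : G, MDifferentiableAt I I (a * ·) x := fun a x =>
    (contMDiff_mul_left (I := I) (n := ∞)).contMDiffAt.mdifferentiableAt (by simp)
  have hψd : ∀ x, MDifferentiableAt I I ψ x := fun x =>
    hψ.contMDiff.contMDiffAt.mdifferentiableAt (by simp)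
  have h : ψ ∘ (g * ·) = (ψ g * ·) ∘ ψ := funext fun x => hψ.1 g x
  have h1 := mfderiv_comp (1 : G) (hψd (g * 1)) (hd g 1)
  rw [h, mfderiv_comp (1 : G) (hd (ψ g) _) (hψd 1)] at h1
  have h2 := congrArg (fun K : V →L[ℝ] V => K v) h1
  let K : G → V →L[ℝ] V := fun x => mfderiv I I ψ x
  have h3 : K (g * 1) = K g := congrArg K (mul_one g)
  let M : G → V →L[ℝ] V := fun x => mfderiv I I (ψ g * ·) x
  have h4 : M (ψ 1) = M 1 := congrArg M hψ.map_one
  have h5 := congrArg (fun K : V →L[ℝ] V => K (mulInvariantVectorField v g)) h3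
  have h6 := congrArg (fun K : V →L[ℝ] V => K (mfderivOne I ψ v)) h4
  exact h5.symm.trans (h2.symm.trans h6)

theorem HasLeftDerivAt.comp_aut (hψ : IsLieGroupAut I ψ) {f : G → ℝ}
    {l : GroupLieAlgebra I G → ℝ} {g : G} (hf : HasLeftDerivAt I f l (ψ g)) :
    HasLeftDerivAt I (fun x => f (ψ x)) (fun v => l (mfderivOne I ψ v)) g := by
  obtain ⟨a, ha, ha'⟩ := hf
  refine ⟨_, ha.comp g (hψ.contMDiff.contMDiffAt.mdifferentiableAt (by simp)).hasMFDerivAt,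
    fun v => ?_⟩
  exact (congrArg a (mfderiv_mulInvariantVectorField hψ g v)).trans (ha' _)

variable [CompleteSpace V]

/-- By the previous naturality, `ψ` pulls left-invariant fields back to left-invariant fields, and
pullback commutes with brackets; evaluate at the identity. -/
theorem mfderivOne_lie (hψ : IsLieGroupAut I ψ) (v w : GroupLieAlgebra I G) :
    mfderivOne I ψ ⁅v, w⁆ = ⁅mfderivOne I ψ v, mfderivOne I ψ w⁆ := by
  have hp : ∀ u : GroupLieAlgebra I G, mpullback I I ψ (mulInvariantVectorField (mfderivOne I ψ u))
      = mulInvariantVectorField u := by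
    intro u
    funext g
    rw [mpullback_apply, ← mfderiv_mulInvariantVectorField hψ]
    exact (hψ.isInvertible_mfderiv g).inverse_apply_self _
  have : IsManifold I (minSmoothness ℝ 3) G := inferInstance
  have h := mpullback_mlieBracket (n := ∞) (x₀ := (1 : G)) (f := ψ)
    (mdifferentiableAt_mulInvariantVectorField (I := I) (G := G) (mfderivOne I ψ v))
    (mdifferentiableAt_mulInvariantVectorField (I := I) (G := G) (mfderivOne I ψ w))
    hψ.contMDiff.contMDiffAt (by simpa using! ENat.LEInfty.out)
  rw [hp, hp, mpullback_apply] at h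
  have h1 := congrArg (mfderiv I I ψ (1 : G)) h
  have h2 := (hψ.isInvertible_mfderiv (1 : G)).self_apply_inverse
    (mlieBracket I (mulInvariantVectorField (mfderivOne I ψ v))
      (mulInvariantVectorField (mfderivOne I ψ w)) (ψ 1))
  have h3 : (mlieBracket I (mulInvariantVectorField (mfderivOne I ψ v))
      (mulInvariantVectorField (mfderivOne I ψ w)) (ψ 1) : V) =
      mlieBracket I (mulInvariantVectorField (mfderivOne I ψ v))
      (mulInvariantVectorField (mfderivOne I ψ w)) (1 : G) :=
    congrArg (fun x => (mlieBracket I (mulInvariantVectorField (mfderivOne I ψ v))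
      (mulInvariantVectorField (mfderivOne I ψ w)) x : V)) hψ.map_one
  exact h1.symm.trans (h2.trans h3)

end Automorphisms

/-! ### Affine coordinates and linear flows -/

section LinearFlows

/-- The difference quotients vanish along the increments `T / (N + 1)`, which tend to zero. -/
theorem eq_zero_of_periods {w : ℝ → ℝ} {d T t : ℝ} (hT : 0 < T) (hw : HasDerivAt w d t)
    (hp : ∀ N : ℕ, w (t + T / (N + 1)) = w t) : d = 0 := by
  have h := hasDerivAt_iff_tendsto_slope_zero.1 hw
  have hseq : Tendsto (fun N : ℕ => T / ((N : ℝ) + 1)) atTop (𝓝[≠] 0) := by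
    refine tendsto_nhdsWithin_iff.2 ⟨?_, .of_forall fun N => ?_⟩
    · exact Filter.Tendsto.div_atTop tendsto_const_nhds
        (tendsto_atTop_add_const_right _ _ tendsto_natCast_atTop_atTop)
    · have : 0 < T / ((N : ℝ) + 1) := by positivity
      exact this.ne'
  refine tendsto_nhds_unique (h.comp hseq) ?_
  simp [Function.comp_def, hp]

variable {V : Type*} [NormedAddCommGroup V] [NormedSpace ℝ V]
  {H : Type*} [TopologicalSpace H] {I : ModelWithCorners ℝ V H}
  {G : Type*} [TopologicalSpace G] [ChartedSpace H G] [Group G]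

variable (I) in
/-- Every automorphism of `G` preserves `s` and acts on `u` by an affine bijection that depends
on the value of `s` only. -/
def IsAffineCoord (s u : G → ℝ) : Prop :=
  ∀ ψ : G → G, IsLieGroupAut I ψ → (∀ g, s (ψ g) = s g) ∧
    ∃ p : ℝ, p ≠ 0 ∧ ∃ c : ℝ → ℝ, ∀ g, u (ψ g) = p * u g + c (s g)

/-- The square of an automorphism acts on an affine coordinate by an increasing map, so it fixes
the coordinate of each of its periodic points. -/
theorem IsAffineCoord.eq_of_iterate_eq {s u : G → ℝ} (hu : IsAffineCoord I s u) {ψ : G → G}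
    (hψ : IsLieGroupAut I ψ) {N : ℕ} (hN : 0 < N) {g : G} (hg : (ψ ∘ ψ)^[N] g = g) :
    u (ψ (ψ g)) = u g := by
  obtain ⟨hs, p, hp, c, hc⟩ := hu ψ hψ
  -- The factor `p` may be negative; squaring gives slope `p * p > 0`. The same `c (s g)` serves at
  -- every iterate because `s` is preserved.
  let F : ℝ → ℝ := fun x => p * (p * x + c (s g)) + c (s g)
  have hF : StrictMono F := by
    intro x y hxy
    have : 0 < p * p * (y - x) := mul_pos (mul_self_pos.2 hp) (sub_pos.2 hxy)
    simp only [F]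
    nlinarith
  have hit : ∀ n, s ((ψ ∘ ψ)^[n] g) = s g ∧ u ((ψ ∘ ψ)^[n] g) = F^[n] (u g) := by
    intro n
    induction n with
    | zero => simp
    | succ n ih =>
      rw [Function.iterate_succ_apply', Function.iterate_succ_apply', Function.comp_apply]
      refine ⟨by rw [hs, hs, ih.1], ?_⟩
      rw [hc, hc, hs, ih.1, ih.2]
  have h1 : F^[N] (u g) = id^[N] (u g) := by
    rw [← (hit N).2, hg, Function.iterate_id, id]
  have h2 := (Function.Commute.iterate_pos_eq_iff_map_eq (f := F) (g := id)
    (Function.Commute.id_right) hF.monotone strictMono_id hN).1 h1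
  rw [hc, hc, hs]
  exact h2

variable [LieGroup I ∞ G]

/-- The one-parameter law is not part of the definition of the flow; it follows from uniqueness of
integral curves. -/
theorem IsLinearFlow.map_add [I.Boundaryless] [CompleteSpace V] [T2Space G]
    {X : ∀ g : G, TangentSpace I g} {φ : ℝ → G → G} (hφ : IsLinearFlow I X φ) (a b : ℝ) (g : G) :
    φ (a + b) g = φ a (φ b g) := by
  have : IsManifold I 1 G := IsManifold.of_le (n := ∞) (by simp)
  have h := isMIntegralCurve_Ioo_eq_of_contMDiff_boundaryless (t₀ := 0)
    (hφ.smooth.of_le (by simp)) ((hφ.isFlowOf.isMIntegralCurve g).comp_add b)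
    (hφ.isFlowOf.isMIntegralCurve (φ b g))
    (by simp [hφ.isFlowOf.map_zero])
  exact congrFun h a

theorem IsLinearFlow.iterate [I.Boundaryless] [CompleteSpace V] [T2Space G]
    {X : ∀ g : G, TangentSpace I g} {φ : ℝ → G → G} (hφ : IsLinearFlow I X φ) (r : ℝ) (N : ℕ)
    (g : G) : (φ (r / 2) ∘ φ (r / 2))^[N] g = φ (N * r) g := by
  induction N with
  | zero => simp [hφ.isFlowOf.map_zero]
  | succ n ih =>
    rw [Function.iterate_succ_apply', ih, Function.comp_apply, ← hφ.map_add, ← hφ.map_add]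
    congr 1
    push_cast
    ring

/-- An affine coordinate is stationary along periodic orbits. -/
theorem IsAffineCoord.apply_eq_zero [I.Boundaryless] [CompleteSpace V] [T2Space G]
    {s u : G → ℝ} (hu : IsAffineCoord I s u) {X : ∀ g : G, TangentSpace I g} {φ : ℝ → G → G}
    (hφ : IsLinearFlow I X φ) {T : ℝ} (hT : 0 < T) {g : G} (hg : ∀ t, φ (t + T) g = φ t g)
    {u' : TangentSpace I (φ 0 g) →L[ℝ] ℝ} (hu' : HasMFDerivAt I 𝓘(ℝ, ℝ) u (φ 0 g) u') :
    u' (X (φ 0 g)) = 0 := by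
  have h1 := hu'.comp (0 : ℝ) (f := fun t => φ t g) (hφ.isFlowOf.isMIntegralCurve g 0)
  have h2 : HasDerivAt (fun t => u (φ t g)) (u' (X (φ 0 g))) 0 := by
    have h3 := (hasMFDerivAt_iff_hasFDerivAt.1 h1)
    obtain ⟨D, hD, hDv⟩ : ∃ D : ℝ →L[ℝ] ℝ, HasFDerivAt (fun t => u (φ t g)) D 0 ∧
        D 1 = u' ((1 : ℝ) • X (φ 0 g)) := ⟨_, h3, rfl⟩
    rw [one_smul] at hDv
    rw [← hDv]
    exact hD.hasDerivAt
  refine eq_zero_of_periods hT h2 fun N => ?_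
  have hN : (0 : ℝ) < N + 1 := by positivity
  have hfix : (φ (T / (N + 1) / 2) ∘ φ (T / (N + 1) / 2))^[N + 1] g = g := by
    rw [hφ.iterate]
    have := hg 0
    rw [zero_add, hφ.isFlowOf.map_zero] at this
    have hT' : ((N + 1 : ℕ) : ℝ) * (T / (N + 1)) = T := by
      push_cast
      field_simp
    rw [hT', this]
  have h4 := hu.eq_of_iterate_eq (hφ.isLieGroupAut _) N.succ_pos hfix
  rw [← hφ.map_add, add_halves] at h4
  rw [zero_add, h4, hφ.isFlowOf.map_zero]

/-- Global affine coordinates whose differentials are independent everywhere. -/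
theorem exists_affineCoords [FiniteDimensional ℝ V] [CompleteSpace V] [I.Boundaryless]
    [SimplyConnectedSpace G] (hG : IsTypeG21G1 (GroupLieAlgebra I G)) :
    ∃ (s : G → ℝ) (u : Fin 3 → G → ℝ), (∀ i, IsAffineCoord I s (u i)) ∧
      ∀ g, ∃ u' : Fin 3 → TangentSpace I g →L[ℝ] ℝ,
        (∀ i, HasMFDerivAt I 𝓘(ℝ, ℝ) (u i) g (u' i)) ∧ ∀ X, (∀ i, u' i X = 0) → X = 0 := by
  obtain ⟨E, hE⟩ := exists_isAdaptedBasis hG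
  have hone : ∀ g : G, HasLeftDerivAt I (fun _ => (1 : ℝ))
      (fun v => 1 * (0 : GroupLieAlgebra I G →ₗ[ℝ] ℝ) v) g := fun g =>
    ⟨0, hasMFDerivAt_const _ _, fun v => by simp⟩
  obtain ⟨s, hs1, hs⟩ := exists_primitive (α := E.coord 2) (β := 0)
    (fun v w => by simp [hE.repr_lie_two]) hone
  obtain ⟨z, hz1, hz⟩ := exists_primitive (α := E.coord 0 + E.coord 1) (β := 0)
    (fun v w => by simp [hE.repr_lie_zero, hE.repr_lie_one]) hone
  -- `E^0 - E^1` is not closed; the eigenvalue 2 of `ad (E 2)` dictates the integrating factor `exp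
  -- (2 s)`.
  obtain ⟨y, hy1, hy⟩ := exists_primitive (I := I) (h := fun g => Real.exp (2 * s g))
    (α := E.coord 0 - E.coord 1) (β := (2 : ℝ) • E.coord 2)
    (fun v w => by simp [hE.repr_lie_zero, hE.repr_lie_one]; ring) (fun g => by
      have hu : HasDerivAt (fun t => Real.exp (2 * t)) (Real.exp (2 * s g) * (2 * 1)) (s g) :=
        ((hasDerivAt_id _).const_mul 2).exp
      convert! (hs g).scomp hu using 2
      simp
      ring)
  -- In each formula both sides have the same left derivatives, so they differ by a constant, which
  -- is zero at the identity. The term `a / 2 * exp (2 s)` is a primitive of `a * exp (2 s) * E^2`.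
  have aut : ∀ ψ : G → G, IsLieGroupAut I ψ → ∃ p q a b : ℝ, p ≠ 0 ∧ q ≠ 0 ∧ ∀ g,
      s (ψ g) = s g ∧ z (ψ g) = q * z g + b * s g ∧
      y (ψ g) = p * y g + (a / 2 * Real.exp (2 * s g) - a / 2) := by
    intro ψ hψ
    obtain ⟨p, q, a, b, hp, hq, h⟩ := hE.repr_endomorphism (mfderivOne_injective hψ)
      (mfderivOne_lie hψ)
    have hsψ : ∀ g, s (ψ g) = s g := by
      intro g
      have := eq_of_hasLeftDerivAt_zero (I := I) (f := fun g => s (ψ g) - s g) (fun g => by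
        convert! (HasLeftDerivAt.comp_aut hψ (hs (ψ g))).sub (hs g) using 2
        simp [(h _).1]) g 1
      simp only [hψ.map_one, sub_self] at this
      linarith
    refine ⟨p, q, a, b, hp, hq, fun g => ⟨hsψ g, ?_, ?_⟩⟩
    · have := eq_of_hasLeftDerivAt_zero (I := I) (f := fun g => z (ψ g) - q * z g - b * s g)
        (fun g => by
          have hl : ∀ k x : ℝ, HasDerivAt (fun t => k * t) k x := fun k x => by
            simpa using (hasDerivAt_id x).const_mul k
          convert! ((HasLeftDerivAt.comp_aut hψ (hz (ψ g))).sub ((hz g).scomp (hl q _))).sub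
            ((hs g).scomp (hl b _)) using 2
          simp [(h _).2.2]) g 1
      simp only [hψ.map_one, hz1, hs1] at this
      linarith
    · have := eq_of_hasLeftDerivAt_zero (I := I)
        (f := fun g => y (ψ g) - p * y g - a / 2 * Real.exp (2 * s g))
        (fun g => by
          have hl : ∀ k x : ℝ, HasDerivAt (fun t => k * t) k x := fun k x => by
            simpa using (hasDerivAt_id x).const_mul k
          have hu : HasDerivAt (fun t => a / 2 * Real.exp (2 * t))
              (a / 2 * (Real.exp (2 * s g) * (2 * 1))) (s g) :=
            (((hasDerivAt_id _).const_mul 2).exp).const_mul _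
          convert! ((HasLeftDerivAt.comp_aut hψ (hy (ψ g))).sub ((hy g).scomp (hl p _))).sub
            ((hs g).scomp hu) using 2
          simp [(h _).2.1, hsψ]
          ring) g 1
      simp only [hψ.map_one, hy1, hs1] at this
      simp at this
      linarith
  refine ⟨s, ![s, z, y], fun i ψ hψ => ?_, fun g => ?_⟩
  · obtain ⟨p, q, a, b, hp, hq, h⟩ := aut ψ hψ
    refine ⟨fun g => (h g).1, ?_⟩
    fin_cases i
    · exact ⟨1, one_ne_zero, 0, fun g => by simpa using (h g).1⟩
    · exact ⟨q, hq, fun t => b * t, fun g => (h g).2.1⟩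
    · exact ⟨p, hp, fun t => a / 2 * Real.exp (2 * t) - a / 2, fun g => (h g).2.2⟩
  · obtain ⟨s', hs', hs0⟩ := hs g
    obtain ⟨z', hz', hz0⟩ := hz g
    obtain ⟨y', hy', hy0⟩ := hy g
    refine ⟨![s', z', y'], fun i => by fin_cases i <;> assumption, fun X hX => ?_⟩
    obtain ⟨v, rfl⟩ := (mulInvariantVectorField_bijective (I := I) g).2 X
    have e0 := (hs0 v).symm.trans (hX 0)
    have e1 := (hz0 v).symm.trans (hX 1)
    have e2 := (hy0 v).symm.trans (hX 2)
    simp only [LinearMap.add_apply, LinearMap.sub_apply, Module.Basis.coord_apply, one_mul,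
      mul_eq_zero, Real.exp_ne_zero, false_or] at e0 e1 e2
    have hv : v = 0 := by
      apply E.repr.injective
      ext i
      fin_cases i <;> simp <;> linarith
    subst hv
    exact map_zero (mfderiv I I (g * ·) (1 : G))

theorem IsLinearFlow.not_isPeriodicOrbit [FiniteDimensional ℝ V] [CompleteSpace V]
    [I.Boundaryless] [T2Space G] [SimplyConnectedSpace G]
    (hG : IsTypeG21G1 (GroupLieAlgebra I G)) {X : ∀ g : G, TangentSpace I g} {φ : ℝ → G → G}
    (hφ : IsLinearFlow I X φ) (g : G) : ¬ IsPeriodicOrbit φ g := by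
  rintro ⟨⟨T, hT, hg⟩, hne⟩
  obtain ⟨s, u, hu, hind⟩ := exists_affineCoords hG
  obtain ⟨u', hu', h0⟩ := hind (φ 0 g)
  have hX : X (φ 0 g) = 0 := h0 _ fun i => (hu i).apply_eq_zero hφ hT hg (hu' i)
  -- At a zero of `X` the constant curve is an integral curve, hence by uniqueness the whole orbit.
  have hconst : IsMIntegralCurve (I := I) (fun _ : ℝ => φ 0 g) X := by
    intro t
    rw [hX]
    refine (hasMFDerivAt_const (I := 𝓘(ℝ, ℝ)) (I' := I) (φ 0 g) t).congr_mfderiv ?_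
    exact (ContinuousLinearMap.smulRight_zero _).symm
  have : IsManifold I 1 G := IsManifold.of_le (n := ∞) (by simp)
  have h := isMIntegralCurve_Ioo_eq_of_contMDiff_boundaryless (t₀ := 0)
    (hφ.smooth.of_le (by simp)) (hφ.isFlowOf.isMIntegralCurve g) hconst rfl
  exact hne fun t => (congrFun h t).trans (hφ.isFlowOf.map_zero g)

end LinearFlows

theorem mainTheorem8 :
    -- the derivations and their eigenvalues
    (∀ (L : Type*) [LieRing L] [LieAlgebra ℝ L], IsTypeG21G1 L →
      (∃ E : Module.Basis (Fin 3) ℝ L, IsAdaptedBasis E) ∧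
      ∀ E : Module.Basis (Fin 3) ℝ L, IsAdaptedBasis E →
        ∀ D : LieDerivation ℝ L L, ∃ x₁ x₂ x₃ y₃ : ℝ,
          LinearMap.toMatrix E E (D : L →ₗ[ℝ] L) =
            !![x₁, x₂, x₃;
               x₂, x₁, y₃;
               0, 0, 0] ∧
          (∀ μ : ℂ, Module.End.HasEigenvalue ((D : L →ₗ[ℝ] L).baseChange ℂ) μ ↔
            μ = 0 ∨ μ = ((x₁ - x₂ : ℝ) : ℂ) ∨ μ = ((x₁ + x₂ : ℝ) : ℂ)) ∧
          (LinearMap.toMatrix E E (D : L →ₗ[ℝ] L)).charpoly.aroots ℂ =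
            {0, ((x₁ - x₂ : ℝ) : ℂ), ((x₁ + x₂ : ℝ) : ℂ)}) ∧
    -- the linear flows
    (∀ (V : Type*) [NormedAddCommGroup V] [NormedSpace ℝ V] [FiniteDimensional ℝ V]
      [CompleteSpace V] (H : Type*) [TopologicalSpace H] (I : ModelWithCorners ℝ V H)
      [I.Boundaryless] (G : Type*) [TopologicalSpace G] [T2Space G] [ChartedSpace H G]
      [Group G] [LieGroup I ∞ G] [SimplyConnectedSpace G],
      IsTypeG21G1 (GroupLieAlgebra I G) →
      ∀ (X : ∀ g : G, TangentSpace I g) (φ : ℝ → G → G), IsLinearFlow I X φ →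
        ¬ ∃ g : G, IsPeriodicOrbit φ g) := by
  refine ⟨fun L _ _ hL => ⟨exists_isAdaptedBasis hL, fun E hE D => hE.derivation D⟩, ?_⟩
  intro V _ _ _ _ H _ I _ G _ _ _ _ _ _ hG X φ hφ
  rintro ⟨g, hg⟩
  exact hφ.not_isPeriodicOrbit hG g hg
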